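/- Let $G$ be a commutator-relators group, that is, a group with a finite presentation $G=\langle x_1,\dots,x_n\mid r_1,\dots,r_m\rangle$, with quotient map $\phi:F\to G$ from the free group $F$ on $x_1,\dots,x_n$, all of whose relators $r_k$ lie in the commutator subgroup $[F,F]$. Assume that $H_2(G)=H_2(G;\mathbb{Z})$ is torsion-free, and let $K$ be a field. Let $\partial_i:\mathbb{Z}F\to\mathbb{Z}F$ be the Fox derivatives, the linear maps with $\partial_i x_j=\delta_{ij}$ and $\partial_i(uv)=\partial_i u+u\,\partial_i v$ for $u,v\in F$; let $\epsilon:\mathbb{Z}F\to\mathbb{Z}$ be the augmentation, and put $\epsilon_{i,j}(w)=\epsilon(\partial_i(\partial_j w))$. The Alexander matrix of the presentation is the $m\times n$ matrix $A$ over $\mathbb{Z}[t_1^{\pm1},\dots,t_n^{\pm1}]$ whose $(k,j)$ entry is the image of $\partial_j r_k$ under the ring homomorphism $x_i\mapsto t_i$. The linearized Alexander matrix $M$ is obtained from $A$ by applying the ring homomorphism $\psi:\mathbb{Z}[t_1^{\pm1},\dots,t_n^{\pm1}]\to\mathbb{Z}[[s_1,\dots,s_n]]$, $t_i\mapsto 1+s_i$,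 and taking the homogeneous part of degree one of each entry. For $\lambda\in K^n$, let $M(\lambda)$ be the matrix over $K$ obtained by substituting $s_i=\lambda_i$. For an integer $d\ge 0$, let $\mathcal{R}_d(G,K)\subseteq H^1(G,K)$ be the set of classes $\lambda$ for which there is a subspace $W\subseteq H^1(G,K)$ with $\dim W=d+1$ and $\lambda\cup w=0$ in $H^2(G,K)$ for all $w\in W$, and let $\mathcal{P}_d(G,K)\subseteq\mathbb{P}(H^1(G,K))$ be the set of points represented by the non-zero elements of $\mathcal{R}_d(G,K)$. Identify $H^1(G,K)=\operatorname{Hom}(G,K)$ with $K^n$ by $f\mapsto(f(\phi(x_1)),\dots,f(\phi(x_n)))$. Then: 1. the entries of $M$ are $M_{k,j}=\sum_{i=1}^n\epsilon_{i,j}(r_k)\,s_i$; 2. $\mathcal{R}_d(G,K)=\{\lambda\in K^n\mid \operatorname{rank}_K M(\lambda)<n-d\}$ for every integer $d\ge0$; 3. $\mathcal{P}_d(G,K)=\{[\lambda]\in\mathbb{P}(K^n)\mid \operatorname{rank}_K M(\lambda)<n-d\}$ for every integer $d\ge0$. -/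

import Mathlib

universe u

noncomputable section

namespace Resonance

/-! ### Group (co)homology, the cup product and resonance varieties -/

/-- `H_2(G) = H_2(G; ℤ)`, the integral homology of `G` (with `ℤ` lifted to the universe of `G`). -/
abbrev IntegralH2 (G : Type u) [Group G] : Type u :=
  groupHomology (Rep.trivial (ULift.{u} ℤ) G (ULift.{u} ℤ)) 2

/-- `H^1(G, K)`, with trivial coefficients. -/
abbrev H1 (G K : Type u) [Group G] [Field K] : Type u :=
  groupCohomology.H1 (Rep.trivial K G K)

/-- `H^2(G, K)`, with trivial coefficients. -/
abbrev H2 (G K : Type u) [Group G] [Field K] : Type u :=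
  groupCohomology.H2 (Rep.trivial K G K)

/-- The homomorphism `G → K` that a class in `H^1(G, K)` is (for trivial coefficients, there are no
non-zero 1-coboundaries, and the 1-cocycles are the homomorphisms). -/
def toHom (G K : Type u) [Group G] [Field K] : H1 G K ≃ₗ[K] (Additive G →+ K) :=
  (groupCohomology.H1IsoOfIsTrivial (Rep.trivial K G K)).toLinearEquiv

/-- The cup product of two homomorphisms `f, g : G → K` on the level of inhomogeneous cochains:
the 2-cocycle `(a, b) ↦ f a * g b`. -/
def cupCocycle {G K : Type u} [Group G] [Field K] (f g : Additive G →+ K) :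
    groupCohomology.cocycles₂ (Rep.trivial K G K) :=
  ⟨fun p => f (Additive.ofMul p.1) * g (Additive.ofMul p.2), by
    rw [groupCohomology.mem_cocycles₂_iff]
    intro a b c
    rw [Rep.trivial_ρ_apply]
    simp only [ofMul_mul, map_add]
    ring⟩

/-- The cup product `H^1(G, K) × H^1(G, K) → H^2(G, K)`. -/
def cup {G K : Type u} [Group G] [Field K] (x y : H1 G K) : H2 G K :=
  groupCohomology.H2π (Rep.trivial K G K) (cupCocycle (toHom G K x) (toHom G K y))

/-- The resonance variety `R_d(G, K) ⊆ H^1(G, K)`: the classes `x` for which there is a subspace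
`W` of dimension `d + 1` with `x ∪ w = 0` for all `w ∈ W`. -/
def resonanceVariety (G K : Type u) [Group G] [Field K] (d : ℕ) : Set (H1 G K) :=
  {x | ∃ W : Submodule K (H1 G K), Module.finrank K W = d + 1 ∧ ∀ w ∈ W, cup x w = 0}

/-- The projective resonance variety `P_d(G, K) ⊆ ℙ(H^1(G, K))`: the image of `R_d(G, K) \ {0}`. -/
def projResonanceVariety (G K : Type u) [Group G] [Field K] (d : ℕ) :
    Set (Projectivization K (H1 G K)) :=
  {p | ∃ (x : H1 G K) (hx : x ≠ 0), x ∈ resonanceVariety G K d ∧ Projectivization.mk K x hx = p}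

/-! ### Fox calculus -/

/-- The group ring `ℤF` of the free group `F` on `x_1, …, x_n`. -/
abbrev ZF (n : ℕ) : Type := MonoidAlgebra ℤ (FreeGroup (Fin n))

/-- The action of `F` on the additive group of `ℤF` by left multiplication. -/
def leftMulAut (n : ℕ) : FreeGroup (Fin n) →* MulAut (Multiplicative (ZF n)) where
  toFun w :=
    { toFun := fun a => Multiplicative.ofAdd (MonoidAlgebra.of ℤ _ w * a.toAdd)
      invFun := fun a => Multiplicative.ofAdd (MonoidAlgebra.of ℤ _ w⁻¹ * a.toAdd)
      left_inv := fun a => by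
        simp only [toAdd_ofAdd, ← mul_assoc, ← map_mul, inv_mul_cancel, map_one, one_mul,
          ofAdd_toAdd]
      right_inv := fun a => by
        simp only [toAdd_ofAdd, ← mul_assoc, ← map_mul, mul_inv_cancel, map_one, one_mul,
          ofAdd_toAdd]
      map_mul' := fun a b => by simp only [toAdd_mul, mul_add, ofAdd_add] }
  map_one' := by
    ext a
    simp
  map_mul' v w := by
    ext a
    simp [mul_assoc]

/-- The homomorphism `w ↦ (∂_i w, w)` from `F` to the semidirect product `ℤF ⋊ F`, which sends
`x_j` to `(δ_{ij}, x_j)`. -/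
def foxLift {n : ℕ} (i : Fin n) :
    FreeGroup (Fin n) →* Multiplicative (ZF n) ⋊[leftMulAut n] FreeGroup (Fin n) :=
  FreeGroup.lift fun j => ⟨Multiplicative.ofAdd (if i = j then 1 else 0), FreeGroup.of j⟩

/-- The Fox derivative `∂_i` on the free group: the map `F → ℤF` with `∂_i x_j = δ_{ij}` and
`∂_i (u v) = ∂_i u + u ∂_i v`, see `foxWord_of` and `foxWord_mul`. -/
def foxWord {n : ℕ} (i : Fin n) (w : FreeGroup (Fin n)) : ZF n := (foxLift i w).left.toAdd

theorem foxLift_right {n : ℕ} (i : Fin n) (w : FreeGroup (Fin n)) : (foxLift i w).right = w := by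
  have h : SemidirectProduct.rightHom.comp (foxLift i) = MonoidHom.id (FreeGroup (Fin n)) := by
    ext j
    simp [foxLift]
  exact DFunLike.congr_fun h w

theorem foxWord_of {n : ℕ} (i j : Fin n) :
    foxWord i (FreeGroup.of j) = if i = j then 1 else 0 := by
  simp [foxWord, foxLift]

theorem foxWord_mul {n : ℕ} (i : Fin n) (u v : FreeGroup (Fin n)) :
    foxWord i (u * v) = foxWord i u + MonoidAlgebra.of ℤ _ u * foxWord i v := by
  rw [foxWord, map_mul, SemidirectProduct.mul_left, foxLift_right]
  rfl

/-- The Fox derivative `∂_i : ℤF → ℤF`, extended linearly from `F`. -/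
def foxDeriv {n : ℕ} (i : Fin n) : ZF n →ₗ[ℤ] ZF n :=
  (Finsupp.linearCombination ℤ (foxWord i)).comp
    (MonoidAlgebra.coeffLinearEquiv ℤ).toLinearMap

theorem foxDeriv_of {n : ℕ} (i : Fin n) (w : FreeGroup (Fin n)) :
    foxDeriv i (MonoidAlgebra.of ℤ _ w) = foxWord i w := by
  simp [foxDeriv]

/-- The augmentation `ε : ℤF → ℤ`. -/
def augmentation (n : ℕ) : ZF n →ₐ[ℤ] ℤ :=
  MonoidAlgebra.lift ℤ ℤ (FreeGroup (Fin n)) 1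

/-- `ε_{i,j}(w) = ε(∂_i (∂_j w))`. -/
def epsilon₂ {n : ℕ} (i j : Fin n) (w : FreeGroup (Fin n)) : ℤ :=
  augmentation n (foxDeriv i (foxDeriv j (MonoidAlgebra.of ℤ _ w)))

/-! ### Commutator-relators groups and the (linearized) Alexander matrix -/

/-- A presentation `G = ⟨x_1, …, x_n ∣ r_1, …, r_m⟩` all of whose relators lie in the commutator
subgroup `[F, F]` of `F = F(n)`; the groups that admit one (for some `n`, `m`) are the
commutator-relators groups. -/
structure CommutatorPresentation (G : Type u) [Group G] (n m : ℕ) where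
  /-- the quotient map `F → G` -/
  φ : FreeGroup (Fin n) →* G
  /-- the relators -/
  rel : Fin m → FreeGroup (Fin n)
  surjective : Function.Surjective φ
  ker_eq : φ.ker = Subgroup.normalClosure (Set.range rel)
  rel_mem : ∀ k, rel k ∈ commutator (FreeGroup (Fin n))

/-- The Laurent polynomial ring `ℤ[t_1^{±1}, …, t_n^{±1}]`, as the group ring of `ℤ^n`. -/
abbrev Laurent (n : ℕ) : Type := MonoidAlgebra ℤ (Multiplicative (Fin n → ℤ))

/-- The ring homomorphism `ℤF → ℤ[t^{±1}]` with `x_i ↦ t_i` (the linear extension of the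
abelianization map of `F`, which is the composite of `φ : F → G` and the abelianization map of a
commutator-relators group `G`). -/
def abelianize (n : ℕ) : ZF n →ₐ[ℤ] Laurent n :=
  MonoidAlgebra.mapDomainAlgHom ℤ ℤ
    (FreeGroup.lift fun i : Fin n => Multiplicative.ofAdd (Pi.single i (1 : ℤ)))

/-- The unit `1 + s_i` of the power series ring `ℤ[[s_1, …, s_n]]`. -/
def onePlus {n : ℕ} (i : Fin n) : (MvPowerSeries (Fin n) ℤ)ˣ where
  val := 1 + MvPowerSeries.X i
  inv := MvPowerSeries.invOfUnit (1 + MvPowerSeries.X i) 1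
  val_inv := MvPowerSeries.mul_invOfUnit _ _ (by simp)
  inv_val := MvPowerSeries.invOfUnit_mul _ _ (by simp)

/-- The ring homomorphism `ψ : ℤ[t^{±1}] → ℤ[[s_1, …, s_n]]` with `t_i ↦ 1 + s_i`. -/
def psi (n : ℕ) : Laurent n →ₐ[ℤ] MvPowerSeries (Fin n) ℤ :=
  MonoidAlgebra.lift ℤ (MvPowerSeries (Fin n) ℤ) (Multiplicative (Fin n → ℤ))
    { toFun := fun a => ((∏ i, onePlus i ^ (a.toAdd i) : (MvPowerSeries (Fin n) ℤ)ˣ) :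
        MvPowerSeries (Fin n) ℤ)
      map_one' := by simp
      map_mul' := fun a b => by
        simp only [toAdd_mul, Pi.add_apply, zpow_add, Finset.prod_mul_distrib, Units.val_mul] }

/-- The homogeneous part of degree one of `ψ`, a linear form in `s_1, …, s_n`. -/
def psiOne {n : ℕ} (a : Laurent n) : MvPolynomial (Fin n) ℤ :=
  ∑ i, MvPolynomial.C (MvPowerSeries.coeff (Finsupp.single i 1) (psi n a)) * MvPolynomial.X i

namespace CommutatorPresentation

variable {G : Type u} [Group G] {n m : ℕ} (P : CommutatorPresentation G n m)

/-- The Alexander matrix, whose `(k, j)` entry is the image of `∂_j r_k` in `ℤ[t^{±1}]`. -/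
def alexanderMatrix : Matrix (Fin m) (Fin n) (Laurent n) :=
  Matrix.of fun k j => abelianize n (foxDeriv j (MonoidAlgebra.of ℤ _ (P.rel k)))

/-- The linearized Alexander matrix `M`, the degree-one part of the image of the Alexander matrix
under `ψ`. -/
def linearizedAlexanderMatrix : Matrix (Fin m) (Fin n) (MvPolynomial (Fin n) ℤ) :=
  P.alexanderMatrix.map psiOne

/-- The matrix `M(v)` over the field `K`, the value of `M` at the point `v ∈ K^n`. -/
def evalMatrix {K : Type*} [Field K] (v : Fin n → K) : Matrix (Fin m) (Fin n) K :=
  P.linearizedAlexanderMatrix.map (MvPolynomial.aeval v)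

/-- A homomorphism from `F` to the additive group of `K` kills the relators. -/
theorem hom_rel {K : Type*} [Field K] (f : FreeGroup (Fin n) →* Multiplicative K) :
    P.φ.ker ≤ f.ker := by
  rw [P.ker_eq]
  refine Subgroup.normalClosure_le_normal ?_
  rintro _ ⟨k, rfl⟩
  exact Abelianization.commutator_subset_ker f (P.rel_mem k)

/-- Evaluation of homomorphisms `G → K` at the generators. -/
def evalHom (K : Type*) [Field K] : (Additive G →+ K) →ₗ[K] (Fin n → K) where
  toFun f i := f (Additive.ofMul (P.φ (FreeGroup.of i)))
  map_add' _ _ := rfl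
  map_smul' _ _ := rfl

theorem evalHom_bijective (K : Type*) [Field K] : Function.Bijective (P.evalHom K) := by
  constructor
  · intro f g h
    have h2 : (AddMonoidHom.toMultiplicativeRight f).comp P.φ =
        (AddMonoidHom.toMultiplicativeRight g).comp P.φ := by
      ext i
      exact congrFun h i
    refine AddMonoidHom.ext fun a => ?_
    obtain ⟨w, hw⟩ := P.surjective a.toMul
    have h3 := DFunLike.congr_fun h2 w
    simp only [MonoidHom.comp_apply, hw] at h3
    exact h3
  · intro v
    let f : FreeGroup (Fin n) →* Multiplicative K :=
      FreeGroup.lift fun i => Multiplicative.ofAdd (v i)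
    let g : G →* Multiplicative K := P.φ.liftOfSurjective P.surjective ⟨f, P.hom_rel f⟩
    refine ⟨AddMonoidHom.toMultiplicativeRight.symm g, ?_⟩
    funext i
    have h : g (P.φ (FreeGroup.of i)) = f (FreeGroup.of i) :=
      P.φ.liftOfRightInverse_comp_apply _ _ ⟨f, P.hom_rel f⟩ _
    change (g (P.φ (FreeGroup.of i))).toAdd = v i
    rw [h]
    simp [f]

/-- The identification `H^1(G, K) = K^n` given by the basis `e_1, …, e_n` that is dual to the classes
of the generators: a class, seen as a homomorphism `f : G → K`, has coordinates `f (x_i)`. -/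
def coords (K : Type u) [Field K] : H1 G K ≃ₗ[K] (Fin n → K) :=
  (toHom G K).trans (LinearEquiv.ofBijective (P.evalHom K) (P.evalHom_bijective K))

end CommutatorPresentation

end Resonance

end

/-!
Let `f, g : G → K` be the homomorphisms with coordinate vectors `v, w ∈ K^n`. On the free group `F`
the function `h(u) = ∑ i j, v i * w j * ε_{i,j}(u)` satisfies `h (a b) = h a + h b + f a * g b`
(`foxQuadratic_mul`), because `ε_{i,j}(a b) = ε_{i,j}(a) + ε_{i,j}(b) + ε_i(a) ε_j(b)` by the product
rule. Thus `-h` cobounds the pullback of the cup product `f ∪ g` to `F`.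

* If `f ∪ g` is the coboundary of `c` on `G`, then `c ∘ φ + h` is a homomorphism on `F`, so it
  vanishes on the relators, which are products of commutators; as `c 1 = 0`, so does `h`.
* If `h` vanishes on the relators, then it vanishes on their normal closure `ker φ` (there `f` and
  `g` are zero, so `h` is additive and conjugation invariant; `eq_zero_of_mem_normalClosure`). Hence
  `h` descends to `G`, and `f ∪ g` is a coboundary.

Since `h(r_k)` is the `k`-th entry of `M(v) w`, the annihilator of `f` in `H^1(G, K)` is the kernel of
`M(v)`, of dimension `n - rank M(v)` (`cup_eq_zero_iff`), and the description of the resonance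
varieties is rank-nullity.

The formula for the entries of `M` says that the degree-one coefficients of `ψ` of the
abelianization of `a ∈ ℤF` are the numbers `ε(∂_i a)` (`coeff_psi_abelianize`). By linearity this is
a statement about words, where both sides are exponent sums.
-/

namespace Resonance

/-! ### Augmented Fox derivatives -/

section Fox

variable {n : ℕ}

@[simp]
theorem augmentation_of (w : FreeGroup (Fin n)) :
    augmentation n (MonoidAlgebra.of ℤ _ w) = 1 := by
  simp [augmentation]

/-- The homomorphism `w ↦ ε(∂_i w)`, the exponent sum of `x_i` in `w`. -/
noncomputable def exponentSum (i : Fin n) : FreeGroup (Fin n) →* Multiplicative ℤ :=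
  MonoidHom.mk' (fun w => Multiplicative.ofAdd (augmentation n (foxWord i w))) fun u v => by
    rw [foxWord_mul, map_add, map_mul, augmentation_of, one_mul, ofAdd_add]

/-- The product rule `∂_i (u a) = ε(a) ∂_i u + u ∂_i a` for `u ∈ F` and `a ∈ ℤF`. -/
theorem foxDeriv_of_mul (i : Fin n) (u : FreeGroup (Fin n)) (a : ZF n) :
    foxDeriv i (MonoidAlgebra.of ℤ _ u * a) =
      augmentation n a • foxWord i u + MonoidAlgebra.of ℤ _ u * foxDeriv i a := by
  induction a using MonoidAlgebra.induction_on with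
  | of v =>
    rw [← map_mul, foxDeriv_of, foxDeriv_of, foxWord_mul, augmentation_of, one_smul]
  | add a b ha hb =>
    rw [mul_add, map_add, ha, hb, map_add, map_add, add_smul, mul_add]
    abel
  | smul r a ha =>
    rw [mul_smul_comm, map_smul, ha, map_smul, map_smul, smul_add, smul_assoc, mul_smul_comm]

theorem epsilon₂_mul (i j : Fin n) (u v : FreeGroup (Fin n)) :
    epsilon₂ i j (u * v) = epsilon₂ i j u + epsilon₂ i j v +
      augmentation n (foxWord i u) * augmentation n (foxWord j v) := by
  simp only [epsilon₂, foxDeriv_of, map_add, foxDeriv_of_mul, map_mul,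
    augmentation_of, map_smul, smul_eq_mul]
  ring

/-! ### The degree-one part of `ψ` -/

theorem coeff_single_one_mul {σ R : Type*} [CommSemiring R] (i : σ) (a b : MvPowerSeries σ R) :
    MvPowerSeries.coeff (Finsupp.single i 1) (a * b) =
      MvPowerSeries.coeff (Finsupp.single i 1) a * MvPowerSeries.constantCoeff b +
        MvPowerSeries.constantCoeff a * MvPowerSeries.coeff (Finsupp.single i 1) b := by
  classical
  rw [MvPowerSeries.coeff_mul, Finsupp.antidiagonal_single]
  simp [Finset.Nat.antidiagonal_succ, add_comm]

theorem psi_abelianize_of (j : Fin n) :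
    psi n (abelianize n (MonoidAlgebra.of ℤ _ (FreeGroup.of j))) = 1 + MvPowerSeries.X j := by
  have h : ∏ i, onePlus i ^ (Pi.single j (1 : ℤ) : Fin n → ℤ) i = onePlus j := by
    rw [Finset.prod_eq_single j (fun i _ hi => by simp [hi]) (by simp)]
    simp
  have h' : psi n (abelianize n (MonoidAlgebra.of ℤ _ (FreeGroup.of j))) =
      (∏ i, onePlus i ^ (Pi.single j (1 : ℤ) : Fin n → ℤ) i : (MvPowerSeries (Fin n) ℤ)ˣ) := by
    simp [psi, abelianize]
    exact one_zsmul _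
  rw [h', h]
  rfl

theorem constantCoeff_psi_abelianize (a : ZF n) :
    MvPowerSeries.constantCoeff (psi n (abelianize n a)) = augmentation n a := by
  induction a using MonoidAlgebra.induction_on with
  | of v =>
    have h : ((MvPowerSeries.constantCoeff (σ := Fin n) (R := ℤ) : MvPowerSeries (Fin n) ℤ →* ℤ).comp
        ((psi n).toRingHom : Laurent n →* MvPowerSeries (Fin n) ℤ)).comp
          (((abelianize n).toRingHom : ZF n →* Laurent n).comp (MonoidAlgebra.of ℤ _)) = 1 := by
      ext j
      change MvPowerSeries.constantCoeff (psi n (abelianize n (MonoidAlgebra.of ℤ _ _))) = 1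
      rw [psi_abelianize_of]
      simp
    rw [augmentation_of]
    exact DFunLike.congr_fun h v
  | add a b ha hb => simp only [map_add, ha, hb]
  | smul r a ha => rw [map_smul, map_smul, map_zsmul, map_zsmul, ha]

/-- The degree-one coefficient of `ψ` at `s_i` is given by the augmented Fox derivative: on words,
both sides are homomorphisms to `ℤ` with value `δ_{ij}` at `x_j`. -/
theorem coeff_psi_abelianize (i : Fin n) (a : ZF n) :
    MvPowerSeries.coeff (Finsupp.single i 1) (psi n (abelianize n a)) =
      augmentation n (foxDeriv i a) := by
  induction a using MonoidAlgebra.induction_on with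
  | of v =>
    rw [foxDeriv_of]
    let L : FreeGroup (Fin n) →* Multiplicative ℤ :=
      MonoidHom.mk' (fun w => Multiplicative.ofAdd (MvPowerSeries.coeff (Finsupp.single i 1)
        (psi n (abelianize n (MonoidAlgebra.of ℤ _ w))))) fun u v => by
          rw [map_mul, map_mul, map_mul, coeff_single_one_mul, constantCoeff_psi_abelianize,
            constantCoeff_psi_abelianize, augmentation_of, augmentation_of, one_mul, mul_one,
            ofAdd_add]
    have h : L = exponentSum i := by
      ext j
      change MvPowerSeries.coeff (Finsupp.single i 1)
        (psi n (abelianize n (MonoidAlgebra.of ℤ _ _))) = augmentation n (foxWord i _)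
      rw [psi_abelianize_of, foxWord_of, map_add, MvPowerSeries.coeff_one, MvPowerSeries.coeff_X]
      simp [apply_ite, Finsupp.single_left_inj]
    exact DFunLike.congr_fun h v
  | add a b ha hb => simp only [map_add, ha, hb]
  | smul r a ha => rw [map_smul, map_smul, map_zsmul, map_zsmul, map_zsmul, ha]

end Fox

namespace CommutatorPresentation

variable {G : Type u} [Group G] {n m : ℕ} (P : CommutatorPresentation G n m)

theorem linearizedAlexanderMatrix_apply (k : Fin m) (j : Fin n) :
    P.linearizedAlexanderMatrix k j =
      ∑ i, MvPolynomial.C (epsilon₂ i j (P.rel k)) * MvPolynomial.X i := by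
  simp only [linearizedAlexanderMatrix, alexanderMatrix, Matrix.map_apply, Matrix.of_apply,
    psiOne, coeff_psi_abelianize, epsilon₂]

theorem evalMatrix_apply {K : Type*} [Field K] (v : Fin n → K) (k : Fin m) (j : Fin n) :
    P.evalMatrix v k j = ∑ i, (epsilon₂ i j (P.rel k) : K) * v i := by
  simp [evalMatrix, linearizedAlexanderMatrix_apply]

end CommutatorPresentation

/-! ### The cochain on the free group that cobounds the cup product -/

/-- The function `u ↦ ∑ i j, v i * w j * ε_{i,j}(u)` on the free group. Its negative cobounds the cup
product of the homomorphisms with coordinate vectors `v` and `w`. -/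
noncomputable def foxQuadratic {n : ℕ} {K : Type*} [Field K] (v w : Fin n → K)
    (u : FreeGroup (Fin n)) : K :=
  ∑ i, ∑ j, v i * w j * (epsilon₂ i j u : K)

namespace CommutatorPresentation

variable {G : Type u} [Group G] {n m : ℕ} (P : CommutatorPresentation G n m)

theorem evalMatrix_mulVec {K : Type*} [Field K] (v w : Fin n → K) (k : Fin m) :
    (P.evalMatrix v).mulVec w k = foxQuadratic v w (P.rel k) := by
  simp only [Matrix.mulVec, dotProduct, evalMatrix_apply, foxQuadratic, Finset.sum_mul]
  rw [Finset.sum_comm]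
  exact Finset.sum_congr rfl fun i _ => Finset.sum_congr rfl fun j _ => by ring

/-- A homomorphism `G → K` is determined by its coordinates through the exponent sums `ε(∂_i u)`. -/
theorem hom_apply_eq_sum {K : Type*} [Field K] (f : Additive G →+ K) (u : FreeGroup (Fin n)) :
    f (Additive.ofMul (P.φ u)) =
      ∑ i, P.evalHom K f i * ((augmentation n (foxWord i u) : ℤ) : K) := by
  let R : FreeGroup (Fin n) →* Multiplicative K :=
    MonoidHom.mk' (fun u => Multiplicative.ofAdd
      (∑ i, P.evalHom K f i * ((augmentation n (foxWord i u) : ℤ) : K))) fun a b => by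
        rw [← ofAdd_add, ← Finset.sum_add_distrib]
        congr 1
        refine Finset.sum_congr rfl fun i _ => ?_
        rw [foxWord_mul, map_add, map_mul, augmentation_of, one_mul, Int.cast_add, mul_add]
  have h : (AddMonoidHom.toMultiplicativeRight f).comp P.φ = R := by
    ext j
    simp [R, foxWord_of, evalHom, apply_ite]
  exact DFunLike.congr_fun h u

theorem foxQuadratic_mul {K : Type*} [Field K] (f g : Additive G →+ K)
    (a b : FreeGroup (Fin n)) :
    foxQuadratic (P.evalHom K f) (P.evalHom K g) (a * b) =
      foxQuadratic (P.evalHom K f) (P.evalHom K g) a +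
        foxQuadratic (P.evalHom K f) (P.evalHom K g) b +
        f (Additive.ofMul (P.φ a)) * g (Additive.ofMul (P.φ b)) := by
  rw [P.hom_apply_eq_sum f, P.hom_apply_eq_sum g, Finset.sum_mul_sum]
  simp only [foxQuadratic, ← Finset.sum_add_distrib]
  refine Finset.sum_congr rfl fun i _ => Finset.sum_congr rfl fun j _ => ?_
  rw [epsilon₂_mul]
  push_cast
  ring

end CommutatorPresentation

/-- A function `h` on a group that is additive up to `f ∪ g` and vanishes on a set `s` vanishes on
the normal closure of `s`, if `f` and `g` vanish there. -/
theorem eq_zero_of_mem_normalClosure {F K : Type*} [Group F] [Field K] {f g : F →* Multiplicative K}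
    {h : F → K} (hmul : ∀ a b, h (a * b) = h a + h b + (f a).toAdd * (g b).toAdd) {s : Set F}
    (hf : Subgroup.normalClosure s ≤ f.ker) (hg : Subgroup.normalClosure s ≤ g.ker)
    (hs : ∀ r ∈ s, h r = 0) {u : F} (hu : u ∈ Subgroup.normalClosure s) : h u = 0 := by
  have h1 : h 1 = 0 := by simpa using hmul 1 1
  let N : Subgroup F :=
    { carrier := {u | u ∈ f.ker ⊓ g.ker ∧ h u = 0}
      one_mem' := ⟨one_mem _, h1⟩
      mul_mem' := fun {a b} ha hb => ⟨mul_mem ha.1 hb.1, by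
        rw [hmul, ha.2, hb.2, MonoidHom.mem_ker.1 ha.1.1]; simp⟩
      inv_mem' := fun {a} ha => ⟨inv_mem ha.1, by
        have := hmul a a⁻¹
        rw [mul_inv_cancel, h1, ha.2, MonoidHom.mem_ker.1 ha.1.1] at this
        simpa using this.symm⟩ }
  have hfg : (f.ker ⊓ g.ker).Normal := inferInstance
  have hN : N.Normal := ⟨fun a ha b => ⟨hfg.conj_mem a ha.1 b, by
    have hb := hmul b b⁻¹
    rw [mul_inv_cancel, h1] at hb
    rw [hmul, hmul, ha.2, map_mul, MonoidHom.mem_ker.1 ha.1.1, MonoidHom.mem_ker.1 ha.1.2]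
    simp only [mul_one, toAdd_one, mul_zero, add_zero]
    exact hb.symm⟩⟩
  have hle : Subgroup.normalClosure s ≤ N := Subgroup.normalClosure_le_normal fun r hr =>
    have hr' := Subgroup.subset_normalClosure hr
    ⟨⟨hf hr', hg hr'⟩, hs r hr⟩
  exact (hle hu).2

/-! ### Cup products and the linearized Alexander matrix -/

namespace CommutatorPresentation

variable {G : Type u} [Group G] {n m : ℕ} (P : CommutatorPresentation G n m)

theorem coords_apply (K : Type u) [Field K] (x : H1 G K) :
    P.coords K x = P.evalHom K (toHom G K x) := rfl

/-- The cup product vanishes if and only if the cochain cobounding it on `F` vanishes on the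
relators. -/
theorem cup_eq_zero_iff {K : Type u} [Field K] (x y : H1 G K) :
    cup x y = 0 ↔ (P.evalMatrix (P.coords K x)).mulVec (P.coords K y) = 0 := by
  rw [cup, groupCohomology.H2π_eq_zero_iff, funext_iff]
  simp only [evalMatrix_mulVec, coords_apply, Pi.zero_apply]
  set f := toHom G K x
  set g := toHom G K y
  set h := foxQuadratic (P.evalHom K f) (P.evalHom K g) with h_def
  have hmul (a b) : h (a * b) = h a + h b + f (.ofMul (P.φ a)) * g (.ofMul (P.φ b)) :=
    P.foxQuadratic_mul f g a b
  constructor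
  · rintro ⟨c, hc⟩ k
    have hc' (a b : G) : c b - c (a * b) + c a = f (.ofMul a) * g (.ofMul b) :=
      congrFun hc (a, b)
    let q : FreeGroup (Fin n) →* Multiplicative K :=
      MonoidHom.mk' (fun u => Multiplicative.ofAdd (c (P.φ u) + h u)) fun a b => by
        rw [← ofAdd_add, hmul, ← hc', map_mul]
        congr 1
        ring
    have hq : c (P.φ (P.rel k)) + h (P.rel k) = 0 :=
      Abelianization.commutator_subset_ker q (P.rel_mem k)
    have hr : P.φ (P.rel k) = 1 := by
      rw [← MonoidHom.mem_ker, P.ker_eq]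
      exact Subgroup.subset_normalClosure ⟨k, rfl⟩
    have h1 : c 1 = 0 := by simpa using hc' 1 1
    rwa [hr, h1, zero_add] at hq
  · intro hr
    have hker {u} (hu : u ∈ P.φ.ker) : h u = 0 := by
      rw [P.ker_eq] at hu
      refine eq_zero_of_mem_normalClosure (f := (AddMonoidHom.toMultiplicativeRight f).comp P.φ)
        (g := (AddMonoidHom.toMultiplicativeRight g).comp P.φ) hmul ?_ ?_ ?_ hu
      · exact P.ker_eq ▸ P.hom_rel _
      · exact P.ker_eq ▸ P.hom_rel _
      · rintro _ ⟨k, rfl⟩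
        exact hr k
    have hconst {a b} (hab : P.φ a = P.φ b) : h a = h b := by
      have hu : a⁻¹ * b ∈ P.φ.ker := by simp [MonoidHom.mem_ker, hab]
      have := hmul a (a⁻¹ * b)
      rw [mul_inv_cancel_left, hker hu, MonoidHom.mem_ker.1 hu] at this
      simpa using this.symm
    -- As `h` is constant on the fibres of `φ`, it factors through `G`.
    choose σ hσ using P.surjective
    refine ⟨fun a => -h (σ a), funext fun ⟨a, b⟩ => ?_⟩
    change -h (σ b) - -h (σ (a * b)) + -h (σ a) = f (.ofMul a) * g (.ofMul b)
    rw [hconst (show P.φ (σ (a * b)) = P.φ (σ a * σ b) by simp only [map_mul, hσ]), hmul, hσ, hσ]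
    ring

/-- A subspace of dimension `d + 1` on which `x ∪ ·` vanishes exists if and only if the kernel of
`M(x)`, which has dimension `n - rank M(x)`, is large enough. -/
theorem mem_resonanceVariety_iff {K : Type u} [Field K] (d : ℕ) (x : H1 G K) :
    x ∈ resonanceVariety G K d ↔ ((P.evalMatrix (P.coords K x)).rank : ℤ) < (n : ℤ) - d := by
  set A := P.evalMatrix (P.coords K x) with hA
  have hrank : A.rank + Module.finrank K (LinearMap.ker A.mulVecLin) = n := by
    have := A.mulVecLin.finrank_range_add_finrank_ker
    rwa [Module.finrank_fin_fun] at this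
  have hiff : x ∈ resonanceVariety G K d ↔
      d + 1 ≤ Module.finrank K (LinearMap.ker A.mulVecLin) := by
    constructor
    · rintro ⟨W, hW, hcup⟩
      rw [← hW, ← LinearEquiv.finrank_map_eq (P.coords K) W]
      refine Submodule.finrank_mono ?_
      rintro _ ⟨w, hw, rfl⟩
      exact (P.cup_eq_zero_iff x w).1 (hcup w hw)
    · intro hd
      obtain ⟨b, hb⟩ := exists_linearIndependent_of_le_finrank hd
      have hb' : LinearIndependent K fun i => (P.coords K).symm (b i) :=
        (hb.map' _ (Submodule.ker_subtype _)).map' _ (P.coords K).symm.ker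
      refine ⟨Submodule.span K (Set.range fun i => (P.coords K).symm (b i)),
        by rw [finrank_span_eq_card hb', Fintype.card_fin], fun w hw => ?_⟩
      have hle : Submodule.span K (Set.range fun i => (P.coords K).symm (b i)) ≤
          (LinearMap.ker A.mulVecLin).comap (P.coords K).toLinearMap := by
        rw [Submodule.span_le]
        rintro _ ⟨i, rfl⟩
        simp
      exact (P.cup_eq_zero_iff x w).2 (hle hw)
  rw [hiff]
  omega

/-- The condition on the rank of `M(v)` only depends on the line spanned by `v`. -/
theorem rank_evalMatrix_smul {K : Type*} [Field K] (a : Kˣ) (v : Fin n → K) :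
    (P.evalMatrix (a • v)).rank = (P.evalMatrix v).rank := by
  have h : P.evalMatrix (a • v) = (a : K) • P.evalMatrix v := by
    ext k j
    simp only [evalMatrix_apply, Matrix.smul_apply, Pi.smul_apply, Units.smul_def, smul_eq_mul,
      Finset.mul_sum]
    exact Finset.sum_congr rfl fun i _ => by ring
  rw [h, Matrix.rank_smul_of_mem_nonZeroDivisors _ (mem_nonZeroDivisors_of_ne_zero a.ne_zero)]

end CommutatorPresentation

end Resonance

theorem mainTheorem3 {G : Type u} [Group G] {n m : ℕ} (P : Resonance.CommutatorPresentation G n m)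
    (hG : IsAddTorsionFree (Resonance.IntegralH2 G)) (K : Type u) [Field K] :
    (∀ k j, P.linearizedAlexanderMatrix k j =
      ∑ i, MvPolynomial.C (Resonance.epsilon₂ i j (P.rel k)) * MvPolynomial.X i) ∧
    (∀ d : ℕ, P.coords K '' Resonance.resonanceVariety G K d =
      {v | ((P.evalMatrix v).rank : ℤ) < (n : ℤ) - d}) ∧
    (∀ d : ℕ, Projectivization.map (P.coords K).toLinearMap (P.coords K).injective ''
        Resonance.projResonanceVariety G K d =
      {p | ∀ (v : Fin n → K) (hv : v ≠ 0), Projectivization.mk K v hv = p →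
        ((P.evalMatrix v).rank : ℤ) < (n : ℤ) - d}) := by
  refine ⟨P.linearizedAlexanderMatrix_apply, fun d => ?_, fun d => ?_⟩
  · ext v
    obtain ⟨x, rfl⟩ := (P.coords K).surjective v
    rw [(P.coords K).injective.mem_set_image, P.mem_resonanceVariety_iff, Set.mem_ofPred_eq]
  · ext p
    constructor
    · rintro ⟨_, ⟨x, hx, hxd, rfl⟩, rfl⟩ v hv hvx
      rw [Projectivization.map_mk, Projectivization.mk_eq_mk_iff] at hvx
      obtain ⟨a, rfl⟩ := hvx
      rw [P.rank_evalMatrix_smul]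
      exact (P.mem_resonanceVariety_iff d x).1 hxd
    · intro hp
      induction p using Projectivization.ind with | h v hv =>
      obtain ⟨x, rfl⟩ := (P.coords K).surjective v
      have hx : x ≠ 0 := fun h => hv (by rw [h, map_zero])
      exact ⟨Projectivization.mk K x hx,
        ⟨x, hx, (P.mem_resonanceVariety_iff d x).2 (hp _ hv rfl), rfl⟩,
        Projectivization.map_mk _ _ _ _⟩
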